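/- Let $\mathcal{I}$ be an index set with $|\mathcal{I}|=4$, $(g_{ab})_{a,b\in\mathcal{I}}$ a constant real symmetric matrix of signature $(-,+,+,+)$, and $\mathcal{U}\subset\mathbb{R}^4$ a simply connected (in particular nonempty and path-connected) open set with coordinates $x^\mu$. Small Latin indices run over $\mathcal{I}$, capital ones are multiindices, repeated indices are summed, and for $|A|=|B_1|+\dots+|B_\ell|=k$ put $$\mathbf{A}_A{}^{B_1\cdots B_\ell}=\tfrac{1}{|B_1|!\cdots|B_\ell|!}\sum_{\pi\in S_k}\operatorname{sgn}(\pi)\,\delta_{a_{\pi(1)}}{}^{b_1}\cdots\delta_{a_{\pi(k)}}{}^{b_k},$$ where $(b_1\ldots b_k)$ is the concatenation of $B_1,\dots,B_\ell$. Let $S^k$ be the real vector space of all $(X,Y)=(X_A{}^\mu,Y_{Am}{}^n)$ with $|A|=k$, totally antisymmetric in $A$, such that $Y_{Am}{}^{\ell}g_{\ell n}+Y_{An}{}^{\ell}g_{\ell m}=\tfrac12 Y_{A\ell}{}^{\ell}g_{mn}$. Let $S^2_{\mathrm{vac}}\subset S^2$ be the subspace of all $(0,W)$ with $\mathbf{A}_A{}^{B}W_B{}^n=0$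 ($|A|=|B|=3$), $W_{Am}{}^{\ell}g_{\ell n}+W_{An}{}^{\ell}g_{\ell m}=0$ and $W_{anm}{}^n=0$. For $\blacklozenge=((E,\Gamma),(0,W))\in C^\infty(\mathcal{U},S^1\times S^2_{\mathrm{vac}})$ let $\mathcal{D}_\blacklozenge\blacklozenge=((T,U),(0,V))$, where, with $|A|=2$, $|C|=3$, $$T_A{}^\mu=-\mathbf{A}_A{}^{bc}\big(E_b{}^\nu\partial_\nu E_c{}^\mu-\Gamma_{bc}{}^\ell E_\ell{}^\mu\big),$$ $$U_{Am}{}^n=W_{Am}{}^n-\mathbf{A}_A{}^{bc}\big(E_b{}^\mu\partial_\mu\Gamma_{cm}{}^n+\Gamma_{cm}{}^\ell\Gamma_{b\ell}{}^n-\Gamma_{bc}{}^\ell\Gamma_{\ell m}{}^n\big),$$ $$V_{Cm}{}^n=\mathbf{A}_C{}^{bA}\big(E_b{}^\mu\partial_\mu W_{Am}{}^n+\Gamma_{b\ell}{}^nW_{Am}{}^\ell-\Gamma_{bm}{}^\ell W_{A\ell}{}^n-2\Gamma_A{}^\ell W_{\ell bm}{}^n\big).$$ Suppose that $\blacklozenge=((E,\Gamma),(0,W))\in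 C^\infty(\mathcal{U},S^1\times S^2_{\mathrm{vac}})$ satisfies $\mathcal{D}_\blacklozenge\blacklozenge=0$ on $\mathcal{U}$ and that the matrix $(E_a{}^\mu)$ is invertible at each point of $\mathcal{U}$, so that the vector fields $E_a=E_a{}^\mu\partial_\mu$ form a frame of $T\mathcal{U}$. Then: 1. The smooth $1$-form $\nu$ on $\mathcal{U}$ given by $\nu(E_a)=-\tfrac12\Gamma_{an}{}^n$ is exact: $\nu=-\mathrm{d}f$ for some $f\in C^\infty(\mathcal{U})$. Moreover, for every $f\in C^\infty(\mathcal{U})$ with $\nu=-\mathrm{d}f$: 2. $g(E_a,E_b)=e^fg_{ab}$ defines a smooth Lorentzian metric $g$ on $\mathcal{U}$, and its (unique) Levi-Civita connection $\nabla$ satisfies $\nabla_{E_a}E_m=\Gamma_{am}{}^nE_n$. 3. The Riemann curvature $R(X,Y)Z=\nabla_X\nabla_YZ-\nabla_Y\nabla_XZ-\nabla_{[X,Y]}Z$ of $\nabla$ satisfies $R(E_a,E_b)E_m=W_{abm}{}^nE_n$. In particular, the Ricci curvature of $g$ vanishes. -/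

import Mathlib

open scoped ContDiff Manifold

noncomputable section

namespace Diamond

/-- The ambient coordinate space `ℝ⁴` (the choice of norm plays no role). -/
abbrev R4 : Type := Fin 4 → ℝ

/-! ### Index notation -/

section Index

variable {ι : Type*} [Fintype ι] [DecidableEq ι]

/-- The symbol `𝐀_A^{B₁ ⋯ B_ℓ}`, where `lens` lists the lengths of `B₁, …, B_ℓ` and `B` is their
concatenation: `1 / (|B₁|! ⋯ |B_ℓ|!) ∑_π sgn π ∏ᵢ δ_{a_{π i}}^{b_i}`. -/
def altSymbol {k : ℕ} (lens : List ℕ) (A B : Fin k → ι) : ℝ :=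
  (((lens.map Nat.factorial).prod : ℕ) : ℝ)⁻¹ *
    ∑ π : Equiv.Perm (Fin k), ((Equiv.Perm.sign π : ℤ) : ℝ) *
      ∏ i, if A (π i) = B i then (1 : ℝ) else 0

/-- Pairs of component arrays `(X_A^μ, Y_{Am}^n)` with `|A| = k`, `m, n ∈ ι`, `μ = 0, …, 3`. The
value of `Y_{Am}^n` is `Y A m n`. -/
abbrev Comp (ι : Type*) (k : ℕ) : Type _ :=
  ((Fin k → ι) → Fin 4 → ℝ) × ((Fin k → ι) → ι → ι → ℝ)

/-- The vector space `S^k` determined by the constant matrix `g`. -/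
def S (g : Matrix ι ι ℝ) (k : ℕ) : Submodule ℝ (Comp ι k) where
  carrier := {p |
    (∀ (σ : Equiv.Perm (Fin k)) A μ, p.1 (A ∘ σ) μ = ((Equiv.Perm.sign σ : ℤ) : ℝ) * p.1 A μ) ∧
    (∀ (σ : Equiv.Perm (Fin k)) A m n,
      p.2 (A ∘ σ) m n = ((Equiv.Perm.sign σ : ℤ) : ℝ) * p.2 A m n) ∧
    (∀ A m n, ∑ l, p.2 A m l * g l n + ∑ l, p.2 A n l * g l m
      = 1 / 2 * (∑ l, p.2 A l l) * g m n)}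
  zero_mem' := by simp
  add_mem' := by
    rintro p q ⟨h1, h2, h3⟩ ⟨k1, k2, k3⟩
    refine ⟨fun σ A μ => ?_, fun σ A m n => ?_, fun A m n => ?_⟩
    · simp only [Prod.fst_add, Pi.add_apply, h1, k1]; ring
    · simp only [Prod.snd_add, Pi.add_apply, h2, k2]; ring
    · have a := h3 A m n
      have b := k3 A m n
      simp only [Prod.snd_add, Pi.add_apply, add_mul, Finset.sum_add_distrib]
      linear_combination a + b
  smul_mem' := by
    rintro c p ⟨h1, h2, h3⟩
    refine ⟨fun σ A μ => ?_, fun σ A m n => ?_, fun A m n => ?_⟩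
    · simp only [Prod.smul_fst, Pi.smul_apply, smul_eq_mul, h1]; ring
    · simp only [Prod.smul_snd, Pi.smul_apply, smul_eq_mul, h2]; ring
    · have a := h3 A m n
      simp only [Prod.smul_snd, Pi.smul_apply, smul_eq_mul, mul_assoc, ← Finset.mul_sum] at a ⊢
      linear_combination c * a

/-- The vacuum subspace `S²_vac`: the elements `(0, W)` of `S²` such that `W_{[abc]}^n = 0`,
`W_{abm}^l g_{ln} + W_{abn}^l g_{lm} = 0` and `W_{anm}^n = 0`. -/
def S2vac (g : Matrix ι ι ℝ) : Submodule ℝ (Comp ι 2) where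
  carrier := {p | p ∈ S g 2 ∧ p.1 = 0 ∧
    (∀ (A : Fin 3 → ι) n,
      ∑ B : Fin 3 → ι, altSymbol [3] A B * p.2 ![B 0, B 1] (B 2) n = 0) ∧
    (∀ A m n, ∑ l, p.2 A m l * g l n + ∑ l, p.2 A n l * g l m = 0) ∧
    (∀ a m, ∑ n, p.2 ![a, n] m n = 0)}
  zero_mem' := by simp
  add_mem' := by
    rintro p q ⟨h0, h1, h2, h3, h4⟩ ⟨k0, k1, k2, k3, k4⟩
    refine ⟨Submodule.add_mem _ h0 k0, by simp [h1, k1], fun A n => ?_, fun A m n => ?_,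
      fun a m => ?_⟩
    · simp only [Prod.snd_add, Pi.add_apply, mul_add, Finset.sum_add_distrib, h2, k2, add_zero]
    · have a := h3 A m n
      have b := k3 A m n
      simp only [Prod.snd_add, Pi.add_apply, add_mul, Finset.sum_add_distrib]
      linear_combination a + b
    · simp only [Prod.snd_add, Pi.add_apply, Finset.sum_add_distrib, h4, k4, add_zero]
  smul_mem' := by
    rintro c p ⟨h0, h1, h2, h3, h4⟩
    refine ⟨Submodule.smul_mem _ c h0, by simp [h1], fun A n => ?_, fun A m n => ?_,
      fun a m => ?_⟩
    · simp only [Prod.smul_snd, Pi.smul_apply, smul_eq_mul, mul_left_comm _ c, ← Finset.mul_sum,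
        h2, mul_zero]
    · have a := h3 A m n
      simp only [Prod.smul_snd, Pi.smul_apply, smul_eq_mul, mul_assoc, ← Finset.mul_sum] at a ⊢
      linear_combination c * a
    · simp only [Prod.smul_snd, Pi.smul_apply, smul_eq_mul, ← Finset.mul_sum, h4, mul_zero]

end Index

/-! ### The operator `𝒟` on fields `♦ = ((E, Γ), (0, W))` -/

section Operator

variable {ι : Type*}

/-- `E_a`, as a vector field on `ℝ⁴`; `E_a^μ` is `frame d a x μ`. -/
def frame (d : R4 → Comp ι 1 × Comp ι 2) (a : ι) (x : R4) : R4 := (d x).1.1 ![a]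

/-- The matrix `(E_a^μ)` at the point `x`. -/
def frameMatrix (d : R4 → Comp ι 1 × Comp ι 2) (x : R4) : Matrix ι (Fin 4) ℝ :=
  Matrix.of fun a μ => frame d a x μ

/-- `Γ_{am}^n`. -/
def conn (d : R4 → Comp ι 1 × Comp ι 2) (a m n : ι) (x : R4) : ℝ := (d x).1.2 ![a] m n

/-- `W_{Am}^n`, `|A| = 2`. -/
def weyl (d : R4 → Comp ι 1 × Comp ι 2) (A : Fin 2 → ι) (m n : ι) (x : R4) : ℝ := (d x).2.2 A m n

/-- `E_b^μ ∂h/∂x^μ`. -/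
def frameDeriv (d : R4 → Comp ι 1 × Comp ι 2) (b : ι) (h : R4 → ℝ) (x : R4) : ℝ :=
  ∑ μ : Fin 4, frame d b x μ * fderiv ℝ h x (Pi.single μ 1)

variable [Fintype ι] [DecidableEq ι]

/-- The components `T_A^μ` of `𝒟_♦ ♦`. -/
def Tcomp (d : R4 → Comp ι 1 × Comp ι 2) (x : R4) (A : Fin 2 → ι) (μ : Fin 4) : ℝ :=
  - ∑ b, ∑ c, altSymbol [1, 1] A ![b, c] *
    (frameDeriv d b (fun y => frame d c y μ) x - ∑ l, conn d b c l x * frame d l x μ)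

/-- The components `U_{Am}^n` of `𝒟_♦ ♦`. -/
def Ucomp (d : R4 → Comp ι 1 × Comp ι 2) (x : R4) (A : Fin 2 → ι) (m n : ι) : ℝ :=
  weyl d A m n x - ∑ b, ∑ c, altSymbol [1, 1] A ![b, c] *
    (frameDeriv d b (conn d c m n) x + ∑ l, conn d c m l x * conn d b l n x
      - ∑ l, conn d b c l x * conn d l m n x)

/-- The components `V_{Cm}^n` of `𝒟_♦ ♦`. -/
def Vcomp (d : R4 → Comp ι 1 × Comp ι 2) (x : R4) (C : Fin 3 → ι) (m n : ι) : ℝ :=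
  ∑ b, ∑ A : Fin 2 → ι, altSymbol [1, 2] C ![b, A 0, A 1] *
    (frameDeriv d b (weyl d A m n) x + ∑ l, conn d b l n x * weyl d A m l x
      - ∑ l, conn d b m l x * weyl d A l n x
      - 2 * ∑ l, conn d (A 0) (A 1) l x * weyl d ![l, b] m n x)

/-- `𝒟_♦ ♦ = ((T, U), (0, V))`. -/
def superD (d : R4 → Comp ι 1 × Comp ι 2) (x : R4) : Comp ι 2 × Comp ι 3 :=
  ((Tcomp d x, Ucomp d x), (0, Vcomp d x))

end Operator

/-! ### Lorentzian geometry on an open subset of `ℝ⁴`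

Tensor fields on an open set `U` are given by functions on `ℝ⁴`, of which only the restriction to
`U` matters. -/

/-- A bilinear form `B` has signature `(-,+,+,+)`. -/
def HasLorentzSignature {V : Type*} [AddCommGroup V] [Module ℝ V] (B : V → V → ℝ) : Prop :=
  ∃ b : Module.Basis (Fin 4) ℝ V, ∀ i j,
    B (b i) (b j) = if i = j then (if i = 0 then -1 else 1) else 0

/-- `G` is a smooth Lorentzian metric of signature `(-,+,+,+)` on `U`. -/
structure IsLorentzianMetricOn (U : Set R4) (G : R4 → R4 →L[ℝ] R4 →L[ℝ] ℝ) : Prop where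
  smooth : ContDiffOn ℝ ∞ G U
  symm : ∀ x ∈ U, ∀ v w, G x v w = G x w v
  signature : ∀ x ∈ U, HasLorentzSignature fun v w => G x v w

/-- `D` is a Levi-Civita connection of the metric `G` on the open set `U`: a smooth covariant
derivative on the tangent bundle, torsion-free and compatible with `G`. The vector `(∇_X Y)(x)` is
`D Y x (X x)`. -/
structure IsLeviCivitaOn (U : Set R4) (G : R4 → R4 →L[ℝ] R4 →L[ℝ] ℝ)
    (D : (R4 → R4) → R4 → R4 →L[ℝ] R4) : Prop where
  cov : IsCovariantDerivativeOn (I := 𝓘(ℝ, R4)) (V := fun x : R4 => TangentSpace 𝓘(ℝ, R4) x)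
    R4 D U
  smooth : ∀ Y : R4 → R4, ContDiffOn ℝ ∞ Y U → ContDiffOn ℝ ∞ (fun x => D Y x) U
  torsion_free : ∀ (X Y : R4 → R4), ∀ x ∈ U, DifferentiableAt ℝ X x → DifferentiableAt ℝ Y x →
    D Y x (X x) - D X x (Y x) = VectorField.lieBracket ℝ X Y x
  metric : ∀ (Y Z : R4 → R4), ∀ x ∈ U, DifferentiableAt ℝ Y x → DifferentiableAt ℝ Z x →
    ∀ v, fderiv ℝ (fun y => G y (Y y) (Z y)) x v = G x (D Y x v) (Z x) + G x (Y x) (D Z x v)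

/-- The Riemann curvature `R(X, Y) Z = ∇_X ∇_Y Z - ∇_Y ∇_X Z - ∇_{[X, Y]} Z` of the connection `D`,
evaluated at `x`. -/
def curvature (D : (R4 → R4) → R4 → R4 →L[ℝ] R4) (X Y Z : R4 → R4) (x : R4) : R4 :=
  D (fun y => D Z y (Y y)) x (X x) - D (fun y => D Z y (X y)) x (Y x)
    - D Z x (VectorField.lieBracket ℝ X Y x)

/-- The Ricci curvature `Ric(Y, Z)`, the trace of `X ↦ R(X, Y) Z`, computed in the coordinate frame
`∂/∂x^μ`, evaluated at `x`. -/
def ricci (D : (R4 → R4) → R4 → R4 →L[ℝ] R4) (Y Z : R4 → R4) (x : R4) : ℝ :=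
  ∑ μ : Fin 4, curvature D (fun _ => Pi.single μ 1) Y Z x μ

end Diamond

end

/-! Let `∇ = d + η` be the connection with `∇_{E_a} E_m = Γ_{am}^n E_n`. The equation `T = 0` says
that `[E_a, E_b] = (Γ_{ab}^l - Γ_{ba}^l) E_l`, so `∇` is torsion-free. The equation `U = 0` then
says that its curvature in the frame is `W` (`curvature_frame`). Taking the trace of `U = 0` gives
`dν(E_a, E_b) = -½ W_{abn}^n`. This vanishes because `W_{ab}` is skew for `g`
(`S2vac_trace_eq_zero`), so `ν` is closed, hence exact on a simply connected set. If `ν = -df`, then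
`E_a f = ½ Γ_{an}^n`. The condition defining `S^1` is then exactly the compatibility of `∇` with the
metric `e^f g_{ab}` (`fderiv_confMetric`), so `∇` is its Levi-Civita connection. Ricci flatness is
the trace condition on `W`, carried from the frame to coordinates because the curvature is
tensorial. -/

noncomputable section

namespace Diamond

/-! ### Closed 1-forms on simply connected open sets, by covering spaces. -/

section Poincare

open Set Filter Topology

/-- The real line with the discrete topology. -/
def DiscreteReal : Type := ℝ

/-- A discrete fibre makes the projection of the bundle of primitives a covering map. -/
instance : TopologicalSpace DiscreteReal := ⊥

instance : DiscreteTopology DiscreteReal := ⟨rfl⟩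

/-- Translation by `k`. -/
def DiscreteReal.shift (k : ℝ) : DiscreteReal → DiscreteReal :=
  fun c : ℝ => (c + k : ℝ)

variable {E : Type*} [NormedAddCommGroup E] [NormedSpace ℝ E] {U : Set E} {η : E → E →L[ℝ] ℝ}

/-- The difference has zero derivative on `B ∩ C`, which is convex. Convexity of the charts thus
makes each transition function of `primitiveCore` constant on the whole overlap. -/
theorem sub_const_of_hasFDerivAt {B C : Set E} (hB : Convex ℝ B) (hC : Convex ℝ C)
    {F G : E → ℝ} (hF : ∀ y ∈ B, HasFDerivAt F (η y) y)
    (hG : ∀ y ∈ C, HasFDerivAt G (η y) y) {x y : E} (hx : x ∈ B ∩ C) (hy : y ∈ B ∩ C) :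
    F x - G x = F y - G y := by
  have key := (hB.inter hC).norm_image_sub_le_of_norm_hasFDerivWithin_le (f := fun z => F z - G z)
    (f' := fun _ => 0) (C := 0)
    (fun z hz => by
      simpa [Pi.sub_def] using ((hF z hz.1).sub (hG z hz.2)).hasFDerivWithinAt)
    (by simp) hy hx
  simpa [sub_eq_zero] using key

/-- The bundle of germs of local primitives of a closed form, in terms of a family of primitives
on convex sets. -/
def primitiveCore (B : U → Set E) (hBo : ∀ i, IsOpen (B i)) (hBc : ∀ i, Convex ℝ (B i))
    (hB : ∀ i : U, (i : E) ∈ B i) (F : U → E → ℝ)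
    (hF : ∀ i, ∀ y ∈ B i, HasFDerivAt (F i) (η y) y) :
    FiberBundleCore U U DiscreteReal where
  baseSet i := {y | (y : E) ∈ B i}
  isOpen_baseSet i := (hBo i).preimage continuous_subtype_val
  indexAt i := i
  mem_baseSet_at := hB
  -- The coordinate `c` in chart `i` stands for the germ of `F i + c`; this shift keeps that germ
  -- fixed.
  coordChange i j x := DiscreteReal.shift (F i x - F j x)
  coordChange_self i x _ v := by
    rw [sub_self]
    exact add_zero (M := ℝ) v
  continuousOn_coordChange i j := by
    -- A nonempty overlap supplies a point `z` at which to read off the constant shift.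
    rcases (({y : U | (y : E) ∈ B i} ∩ {y : U | (y : E) ∈ B j})).eq_empty_or_nonempty with h | ⟨z, hz⟩
    · rw [h, Set.empty_prod]
      exact continuousOn_empty _
    · have hc : Continuous (fun p : U × DiscreteReal => DiscreteReal.shift (F i z - F j z) p.2) :=
        (continuous_of_discreteTopology (f := DiscreteReal.shift (F i z - F j z))).comp
          continuous_snd
      refine hc.continuousOn.congr fun p hp => ?_
      rw [sub_const_of_hasFDerivAt (hBc i) (hBc j) (hF i) (hF j) hp.1 hz]
  coordChange_comp i j k x _ v := by
    rw [← sub_add_sub_cancel (F i x) (F j x) (F k x)]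
    exact add_assoc (G := ℝ) v _ _

/-- Poincaré lemma for closed 1-forms on simply connected open sets. -/
theorem exists_forall_hasFDerivAt_of_simplyConnectedSpace (hU : IsOpen U)
    (hUsc : SimplyConnectedSpace U) (hη : DifferentiableOn ℝ η U)
    (hdη : ∀ a ∈ U, ∀ x y, fderiv ℝ η a x y = fderiv ℝ η a y x) :
    ∃ f : E → ℝ, ∀ a ∈ U, HasFDerivAt f (η a) a := by
  classical
  have loc : ∀ i : U, ∃ B : Set E, IsOpen B ∧ Convex ℝ B ∧ (i : E) ∈ B ∧
      ∃ F : E → ℝ, ∀ y ∈ B, HasFDerivAt F (η y) y := by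
    rintro ⟨i, hi⟩
    obtain ⟨r, hr, hrU⟩ := Metric.isOpen_iff.mp hU i hi
    refine ⟨Metric.ball i r, Metric.isOpen_ball, convex_ball i r, Metric.mem_ball_self hr, ?_⟩
    exact (convex_ball i r).exists_forall_hasFDerivAt_of_fderiv_symmetric Metric.isOpen_ball
      (hη.mono hrU) fun a ha => hdη a (hrU ha)
  choose B hBo hBc hB F hF using loc
  let Z := primitiveCore B hBo hBc hB F hF
  have cov : IsCoveringMap (Bundle.TotalSpace.proj : Z.TotalSpace → U) :=
    FiberBundle.isCoveringMap
  have : LocallyPathConnectedSpace U := hU.locallyPathConnectedSpace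
  obtain ⟨a₀⟩ : Nonempty U := inferInstance
  -- Simple connectedness lifts the identity of `U` to a global section, that is, a coherent choice
  -- of germs of primitives.
  obtain ⟨s, ⟨-, hs⟩, -⟩ := cov.existsUnique_continuousMap_lifts (ContinuousMap.id U) a₀
    ⟨a₀, (0 : ℝ)⟩ rfl
  have hs' : ∀ x, (s x).1 = x := fun x => congrFun hs x
  -- The fibre coordinate at `x` refers to the chart indexed by `x` itself, hence the value `F x x +
  -- u x` below.
  let u : U → ℝ := fun x => (s x).2
  let f : E → ℝ := fun x => if hx : x ∈ U then F ⟨x, hx⟩ x + u ⟨x, hx⟩ else 0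
  refine ⟨f, fun a ha => ?_⟩
  let i : U := ⟨a, ha⟩
  -- Read in the fixed chart `i`, the section is locally constant by discreteness, so near `a` the
  -- function `f` is `F i` plus a constant.
  let c : U → ℝ := fun x => (Z.localTriv i (s x)).2
  have hcont : ContinuousAt (fun x : U => (Z.localTriv i (s x)).2) i := by
    refine continuous_snd.continuousAt.comp ?_
    refine ContinuousAt.comp ?_ s.continuous.continuousAt
    refine (Z.localTriv i).continuousAt ?_
    rw [Z.mem_localTriv_source, hs']
    exact hB i
  have hev : ∀ᶠ x : U in 𝓝 i, c x = c i :=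
    hcont.eventually (IsOpen.mem_nhds (isOpen_discrete {_}) rfl)
  have hval : ∀ x : U, f x = F i x + c x := by
    intro x
    have h1 : c x = u x + (F (s x).1 (s x).1 - F i (s x).1) := rfl
    rw [h1, hs']
    simp only [f, x.2, dif_pos]
    ring
  have hevE : ∀ᶠ x in 𝓝 a, f x = F i x + c i := by
    rw [nhds_subtype_eq_comap, eventually_comap] at hev
    filter_upwards [hev, hU.mem_nhds ha] with x hx hxU
    rw [← hx ⟨x, hxU⟩ rfl]
    exact hval ⟨x, hxU⟩
  exact ((hF i a (hB i)).add_const _).congr_of_eventuallyEq hevE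

end Poincare

/-! ### Connections on `ℝ⁴` given by a connection form -/

section AffineConnection

/-- The connection `∇_v Y = dY(v) + η(Y, v)`. -/
def affineConn (η : R4 → R4 →L[ℝ] R4 →L[ℝ] R4) (Y : R4 → R4) (x : R4) : R4 →L[ℝ] R4 :=
  fderiv ℝ Y x + η x (Y x)

variable {U : Set R4} {η : R4 → R4 →L[ℝ] R4 →L[ℝ] R4} {G : R4 → R4 →L[ℝ] R4 →L[ℝ] ℝ}

theorem differentiableAt_of_mdifferentiableAt_tangentSection
    {Y : (x : R4) → TangentSpace 𝓘(ℝ, R4) x} {x : R4}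
    (h : MDifferentiableAt 𝓘(ℝ, R4) (𝓘(ℝ, R4).prod 𝓘(ℝ, R4))
      (fun y => (⟨y, Y y⟩ : Bundle.TotalSpace R4 (TangentSpace 𝓘(ℝ, R4) : R4 → Type))) x) :
    DifferentiableAt ℝ (fun y => (Y y : R4)) x := by
  rw [mdifferentiableAt_section, mdifferentiableAt_iff_differentiableAt] at h
  simpa using! h

theorem affineConn_add {Y Z : R4 → R4} {x : R4} (hY : DifferentiableAt ℝ Y x)
    (hZ : DifferentiableAt ℝ Z x) :
    affineConn η (Y + Z) x = affineConn η Y x + affineConn η Z x := by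
  simp only [affineConn, fderiv_add hY hZ, Pi.add_apply, map_add]
  abel

theorem affineConn_smul {h : R4 → ℝ} {Y : R4 → R4} {x : R4} (hh : DifferentiableAt ℝ h x)
    (hY : DifferentiableAt ℝ Y x) :
    affineConn η (h • Y) x = h x • affineConn η Y x + (fderiv ℝ h x).smulRight (Y x) := by
  simp only [affineConn, fderiv_smul hh hY, Pi.smul_apply', map_smul, smul_add]
  abel

theorem isCovariantDerivativeOn_affineConn :
    IsCovariantDerivativeOn (I := 𝓘(ℝ, R4)) (V := fun x : R4 => TangentSpace 𝓘(ℝ, R4) x)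
      R4 (affineConn η) U where
  add hσ hσ' _ := affineConn_add (differentiableAt_of_mdifferentiableAt_tangentSection hσ)
    (differentiableAt_of_mdifferentiableAt_tangentSection hσ')
  leibniz {σ h x} hσ hh _ := by
    have key := affineConn_smul (η := η) (mdifferentiableAt_iff_differentiableAt.mp hh)
      (differentiableAt_of_mdifferentiableAt_tangentSection hσ)
    rw [← mfderiv_eq_fderiv] at key
    exact key

theorem contDiffOn_affineConn (hU : IsOpen U) (hη : ContDiffOn ℝ ∞ η U) {Y : R4 → R4}
    (hY : ContDiffOn ℝ ∞ Y U) : ContDiffOn ℝ ∞ (fun x => affineConn η Y x) U :=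
  (hY.fderiv_of_isOpen hU (by simp)).add (hη.clm_apply hY)

theorem affineConn_sub_affineConn (hsymm : ∀ x ∈ U, ∀ v w, η x v w = η x w v) (X Y : R4 → R4)
    {x : R4} (hx : x ∈ U) :
    affineConn η Y x (X x) - affineConn η X x (Y x) = VectorField.lieBracket ℝ X Y x := by
  simp only [affineConn, add_apply, VectorField.lieBracket,
    hsymm x hx (X x) (Y x)]
  abel

theorem isLeviCivitaOn_affineConn (hU : IsOpen U) (hη : ContDiffOn ℝ ∞ η U)
    (hG : ContDiffOn ℝ ∞ G U) (hsymm : ∀ x ∈ U, ∀ v w, η x v w = η x w v)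
    (hmetric : ∀ x ∈ U, ∀ u v w, fderiv ℝ G x u v w = G x (η x v u) w + G x v (η x w u)) :
    IsLeviCivitaOn U G (affineConn η) where
  cov := isCovariantDerivativeOn_affineConn
  smooth _ hY := contDiffOn_affineConn hU hη hY
  torsion_free X Y _ hx _ _ := affineConn_sub_affineConn hsymm X Y hx
  metric Y Z x hx hY hZ v := by
    have hGx : DifferentiableAt ℝ G x :=
      (hG.contDiffAt (hU.mem_nhds hx)).differentiableAt (by simp)
    have h := ((hGx.hasFDerivAt.clm_apply hY.hasFDerivAt).clm_apply hZ.hasFDerivAt).fderiv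
    rw [h]
    simp [affineConn, hmetric x hx]
    ring

theorem HasLorentzSignature.nondegenerate {V : Type*} [AddCommGroup V] [Module ℝ V]
    {B : V →ₗ[ℝ] V →ₗ[ℝ] ℝ} (hB : HasLorentzSignature fun v w => B v w) {v : V}
    (hv : ∀ w, B v w = 0) : v = 0 := by
  obtain ⟨b, hb⟩ := hB
  refine b.ext_elem fun i => ?_
  have h := hv (b i)
  rw [← b.sum_repr v] at h
  simp only [map_sum, map_smul, LinearMap.sum_apply, LinearMap.smul_apply, hb, smul_eq_mul] at h
  rw [Finset.sum_eq_single i (fun j _ hj => by simp [hj]) (by simp)] at h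
  simp only [↓reduceIte] at h
  split_ifs at h <;> simpa using h

/-- Uniqueness of the Levi-Civita connection. -/
theorem IsLeviCivitaOn.eq_of_differentiableAt {D D' : (R4 → R4) → R4 → R4 →L[ℝ] R4}
    (hG : IsLorentzianMetricOn U G) (h : IsLeviCivitaOn U G D) (h' : IsLeviCivitaOn U G D')
    {Y : R4 → R4} {x : R4} (hx : x ∈ U) (hY : DifferentiableAt ℝ Y x) : D' Y x = D Y x := by
  -- Both connections have the same torsion, so their difference is symmetric. Exchanging the
  -- arguments also reduces an arbitrary `Y` to a constant field, so tensoriality needs no separate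
  -- proof.
  have key : ∀ X Z : R4 → R4, DifferentiableAt ℝ X x → DifferentiableAt ℝ Z x →
      D' Z x (X x) - D Z x (X x) = D' X x (Z x) - D X x (Z x) := fun X Z hX hZ => by
    have h1 := h.torsion_free X Z x hx hX hZ
    rw [← h'.torsion_free X Z x hx hX hZ] at h1
    linear_combination (exp := 1) -h1
  let A : R4 → R4 → R4 := fun y v => D' (fun _ => y) x v - D (fun _ => y) x v
  have hA : ∀ y v, A y v = A v y := fun y v =>
    key (fun _ => v) (fun _ => y) (differentiableAt_const _) (differentiableAt_const _)
  have hskew : ∀ v y z, G x (A y v) z = - G x (A z v) y := fun v y z => by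
    have h1 := h.metric (fun _ => y) (fun _ => z) x hx (differentiableAt_const _)
      (differentiableAt_const _) v
    rw [h'.metric (fun _ => y) (fun _ => z) x hx (differentiableAt_const _)
      (differentiableAt_const _) v, hG.symm x hx y, hG.symm x hx y] at h1
    simp only [A, map_sub, sub_apply]
    linear_combination h1
  have hzero : ∀ y v, A y v = 0 := fun y v => by
    let B : R4 →ₗ[ℝ] R4 →ₗ[ℝ] ℝ := (ContinuousLinearMap.coeLM ℝ).comp (G x : R4 →ₗ[ℝ] R4 →L[ℝ] ℝ)
    refine HasLorentzSignature.nondegenerate (B := B) (hG.signature x hx) fun z => ?_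
    change G x (A y v) z = 0
    -- A trilinear expression symmetric in one pair of arguments and skew in another vanishes, as in
    -- the Koszul formula.
    have e1 := hskew v y z
    have e2 := hskew y v z
    have e3 := hskew z v y
    rw [hA v y] at e2
    rw [hA v z, hA y z] at e3
    linarith
  ext1 v
  have := key (fun _ => v) Y (differentiableAt_const _) hY
  rw [← sub_eq_zero, this]
  exact hzero v (Y x)

/-- The curvature of `∇ = d + η` is tensorial. -/
theorem curvature_affineConn (hU : IsOpen U) (hη : ContDiffOn ℝ ∞ η U)
    (hsymm : ∀ x ∈ U, ∀ v w, η x v w = η x w v) {X Y Z : R4 → R4}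
    (hX : ContDiffOn ℝ ∞ X U) (hY : ContDiffOn ℝ ∞ Y U) (hZ : ContDiffOn ℝ ∞ Z U)
    {x : R4} (hx : x ∈ U) :
    curvature (affineConn η) X Y Z x
      = fderiv ℝ η x (X x) (Z x) (Y x) - fderiv ℝ η x (Y x) (Z x) (X x)
        + η x (η x (Z x) (Y x)) (X x) - η x (η x (Z x) (X x)) (Y x) := by
  have hxU := hU.mem_nhds hx
  have dη : HasFDerivAt η _ x := ((hη.contDiffAt hxU).differentiableAt (by simp)).hasFDerivAt
  have dZ : HasFDerivAt Z _ x := ((hZ.contDiffAt hxU).differentiableAt (by simp)).hasFDerivAt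
  have ddZ : HasFDerivAt (fderiv ℝ Z) _ x :=
    (((hZ.fderiv_of_isOpen hU (m := ∞) (by simp)).contDiffAt hxU).differentiableAt
      (by simp)).hasFDerivAt
  have hsnd : ∀ v w, fderiv ℝ (fderiv ℝ Z) x v w = fderiv ℝ (fderiv ℝ Z) x w v :=
    (hZ.contDiffAt hxU).isSymmSndFDerivAt (by simp; exact WithTop.coe_le_coe.mpr le_top)
  have main : ∀ {P : R4 → R4}, ContDiffOn ℝ ∞ P U → ∀ v,
      affineConn η (fun y => affineConn η Z y (P y)) x v
        = fderiv ℝ (fderiv ℝ Z) x v (P x) + fderiv ℝ Z x (fderiv ℝ P x v)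
          + fderiv ℝ η x v (Z x) (P x) + η x (fderiv ℝ Z x v) (P x) + η x (Z x) (fderiv ℝ P x v)
          + η x (fderiv ℝ Z x (P x)) v + η x (η x (Z x) (P x)) v := by
    intro P hP v
    have dP : HasFDerivAt P _ x := ((hP.contDiffAt hxU).differentiableAt (by simp)).hasFDerivAt
    have h := ((ddZ.add (dη.clm_apply dZ)).clm_apply dP).fderiv
    rw [affineConn]
    change (fderiv ℝ (fun y => (fderiv ℝ Z y + η y (Z y)) (P y)) x + _) v = _
    simp only [Pi.add_def] at h
    rw [h]
    simp [affineConn]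
    abel
  rw [curvature, main hX, main hY]
  simp only [affineConn, VectorField.lieBracket, add_apply, map_sub]
  -- The second derivatives of `Z` cancel by symmetry, the derivatives of `X` and `Y` cancel against
  -- the bracket term, and the remaining first derivatives of `Z` cancel by the symmetry of `η`.
  rw [hsnd (X x) (Y x), hsymm x hx (fderiv ℝ Z x (X x)) (Y x),
    hsymm x hx (fderiv ℝ Z x (Y x)) (X x)]
  simp only [hsymm x hx (Y x), hsymm x hx (X x)]
  abel

end AffineConnection

/-! ### The frame, its dual, and the field equations in components. -/

section Frame

open Topology Matrix

variable {ι : Type*} {d : R4 → Comp ι 1 × Comp ι 2} {U : Set R4}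

theorem contDiffOn_frame [Fintype ι] (hd : ContDiffOn ℝ ∞ d U) (a : ι) :
    ContDiffOn ℝ ∞ (frame d a) U :=
  contDiffOn_pi.mp hd.fst.fst ![a]

theorem contDiffOn_conn [Fintype ι] (hd : ContDiffOn ℝ ∞ d U) (a m n : ι) :
    ContDiffOn ℝ ∞ (conn d a m n) U :=
  contDiffOn_pi.mp (contDiffOn_pi.mp (contDiffOn_pi.mp hd.fst.snd ![a]) m) n

theorem frameDeriv_eq (b : ι) (h : R4 → ℝ) (x : R4) :
    frameDeriv d b h x = fderiv ℝ h x (frame d b x) := by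
  conv_rhs => rw [pi_eq_sum_univ' (frame d b x), map_sum]
  refine Finset.sum_congr rfl fun μ _ => ?_
  rw [map_smul, smul_eq_mul]

variable [Fintype ι]

/-- The linear map `c ↦ c^a E_a`. -/
def frameMap (d : R4 → Comp ι 1 × Comp ι 2) (x : R4) : (ι → ℝ) →L[ℝ] R4 :=
  ∑ a, (ContinuousLinearMap.proj a : (ι → ℝ) →L[ℝ] ℝ).smulRight (frame d a x)

/-- The dual frame of `E_a`, as a map `v ↦ (θ^a(v))`. -/
def coframe (d : R4 → Comp ι 1 × Comp ι 2) (x : R4) : R4 →L[ℝ] (ι → ℝ) :=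
  (frameMap d x).inverse

/-- The dual frame `θ^a`. -/
def dualFrame (d : R4 → Comp ι 1 × Comp ι 2) (a : ι) (x : R4) : R4 →L[ℝ] ℝ :=
  (ContinuousLinearMap.proj a : (ι → ℝ) →L[ℝ] ℝ).comp (coframe d x)

theorem frameMap_apply (x : R4) (c : ι → ℝ) : frameMap d x c = ∑ a, c a • frame d a x := by
  simp [frameMap]

theorem contDiffOn_frameMap (hd : ContDiffOn ℝ ∞ d U) : ContDiffOn ℝ ∞ (frameMap d) U :=
  ContDiffOn.sum fun a _ => contDiffOn_const.smulRight (contDiffOn_frame hd a)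

variable [DecidableEq ι]

/-- The frame is invertible at `x`. -/
def FrameInvertible (d : R4 → Comp ι 1 × Comp ι 2) (x : R4) : Prop :=
  ∃ N : Matrix (Fin 4) ι ℝ, frameMatrix d x * N = 1 ∧ N * frameMatrix d x = 1

theorem FrameInvertible.exists_equiv {x : R4} (h : FrameInvertible d x) :
    ∃ e : (ι → ℝ) ≃L[ℝ] R4, (e : (ι → ℝ) →L[ℝ] R4) = frameMap d x := by
  obtain ⟨N, h1, h2⟩ := h
  have hmap : ∀ c, frameMap d x c = c ᵥ* frameMatrix d x := fun c => by
    ext μ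
    simp [frameMap_apply, Matrix.vecMul, dotProduct, frameMatrix]
  let e : (ι → ℝ) ≃ₗ[ℝ] R4 := LinearEquiv.ofLinearMap (frameMap d x : (ι → ℝ) →ₗ[ℝ] R4)
    N.vecMulLinear
    (LinearMap.ext fun v => by simp [hmap, Matrix.vecMul_vecMul, h2])
    (LinearMap.ext fun v => by simp [hmap, Matrix.vecMul_vecMul, h1])
  exact ⟨e.toContinuousLinearEquiv, by ext; rfl⟩

/-- Inversion of continuous linear maps is smooth at every invertible one. -/
theorem contDiffOn_coframe (hd : ContDiffOn ℝ ∞ d U) (hE : ∀ x ∈ U, FrameInvertible d x) :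
    ContDiffOn ℝ ∞ (coframe d) U := fun x hx => by
  obtain ⟨e, he⟩ := (hE x hx).exists_equiv
  have := contDiffAt_map_inverse (𝕜 := ℝ) (n := ∞) e
  rw [he] at this
  exact this.comp_contDiffWithinAt x (contDiffOn_frameMap hd x hx)

theorem contDiffOn_dualFrame (hd : ContDiffOn ℝ ∞ d U) (hE : ∀ x ∈ U, FrameInvertible d x)
    (a : ι) : ContDiffOn ℝ ∞ (dualFrame d a) U :=
  contDiffOn_const.clm_comp (contDiffOn_coframe hd hE)

theorem FrameInvertible.coframe_frameMap {x : R4} (h : FrameInvertible d x) (c : ι → ℝ) :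
    coframe d x (frameMap d x c) = c := by
  obtain ⟨e, he⟩ := h.exists_equiv
  simp [coframe, ← he]

theorem frameMap_single (x : R4) (a : ι) : frameMap d x (Pi.single a 1) = frame d a x := by
  simp [frameMap_apply, Pi.single_apply]

theorem FrameInvertible.dualFrame_frame {x : R4} (h : FrameInvertible d x) (a b : ι) :
    dualFrame d a x (frame d b x) = if a = b then 1 else 0 := by
  rw [dualFrame, ContinuousLinearMap.comp_apply, ← frameMap_single, h.coframe_frameMap]
  simp [Pi.single_apply]

theorem FrameInvertible.exists_basis {x : R4} (h : FrameInvertible d x) :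
    ∃ b : Module.Basis ι ℝ R4, (∀ a, b a = frame d a x) ∧
      ∀ v a, b.repr v a = dualFrame d a x v := by
  obtain ⟨e, he⟩ := h.exists_equiv
  refine ⟨(Pi.basisFun ℝ ι).map e.toLinearEquiv, fun a => ?_, fun v a => ?_⟩
  · rw [← frameMap_single, ← he]
    simp
  · simp [dualFrame, coframe, ← he]

/-- Reduces multilinear identities on `R4` to frame vectors, where the field equations are stated.
-/
theorem FrameInvertible.induction {x : R4} (h : FrameInvertible d x) {p : R4 → Prop}
    (frame : ∀ a, p (frame d a x)) (add : ∀ v w, p v → p w → p (v + w))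
    (smul : ∀ (c : ℝ) v, p v → p (c • v)) (zero : p 0) (v : R4) : p v := by
  obtain ⟨b, hb, -⟩ := h.exists_basis
  have hv : v ∈ Submodule.span ℝ (Set.range b) := b.span_eq ▸ Submodule.mem_top
  induction hv using Submodule.span_induction with
  | mem v hv => obtain ⟨a, rfl⟩ := hv; rw [hb]; exact frame a
  | zero => exact zero
  | add v w _ _ hv hw => exact add v w hv hw
  | smul c v _ hv => exact smul c v hv

/-! ### Components of `𝒟_♦ ♦ = 0` -/

/-- The symbol with two blocks of length one is a 2×2 determinant of Kronecker deltas. -/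
theorem sum_altSymbol_one_one (a b : ι) (h : ι → ι → ℝ) :
    ∑ b', ∑ c', altSymbol [1, 1] ![a, b] ![b', c'] * h b' c' = h a b - h b a := by
  have key : ∀ b' c', altSymbol [1, 1] ![a, b] ![b', c']
      = (if a = b' then (1 : ℝ) else 0) * (if b = c' then 1 else 0)
        - (if a = c' then 1 else 0) * (if b = b' then 1 else 0) := fun b' c' => by
    have := Matrix.det_fin_two (Matrix.of fun i j : Fin 2 =>
      if ![a, b] i = ![b', c'] j then (1 : ℝ) else 0)
    rw [Matrix.det_apply'] at this
    have h1 : (((([1, 1] : List ℕ).map Nat.factorial).prod : ℕ) : ℝ)⁻¹ = 1 := by simp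
    rw [altSymbol, h1, one_mul]
    exact this
  simp only [key, sub_mul, Finset.sum_sub_distrib]
  simp

/-- This is `T = 0`, read as a formula for the bracket of two frame fields. -/
theorem fderiv_frame_sub (hU : IsOpen U) (hd : ContDiffOn ℝ ∞ d U) {x : R4} (hx : x ∈ U)
    (hD : superD d x = 0) (a b : ι) :
    fderiv ℝ (frame d b) x (frame d a x) - fderiv ℝ (frame d a) x (frame d b x)
      = ∑ l, (conn d a b l x - conn d b a l x) • frame d l x := by
  have hdiff : ∀ c, DifferentiableAt ℝ (frame d c) x := fun c =>
    ((contDiffOn_frame hd c).contDiffAt (hU.mem_nhds hx)).differentiableAt (by simp)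
  ext μ
  have hT : Tcomp d x ![a, b] μ = 0 := congrFun (congrFun (congrArg (fun p => p.1.1) hD) ![a, b]) μ
  rw [Tcomp, sum_altSymbol_one_one] at hT
  simp only [frameDeriv_eq, fderiv_apply (hdiff _)] at hT
  simp only [Pi.sub_apply, Finset.sum_apply, Pi.smul_apply, smul_eq_mul, sub_mul,
    Finset.sum_sub_distrib]
  simp only [ContinuousLinearMap.comp_apply, ContinuousLinearMap.proj_apply] at hT
  linarith

theorem weyl_eq {x : R4} (hD : superD d x = 0) (a b m n : ι) :
    weyl d ![a, b] m n x
      = (fderiv ℝ (conn d b m n) x (frame d a x) + ∑ l, conn d b m l x * conn d a l n x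
          - ∑ l, conn d a b l x * conn d l m n x)
        - (fderiv ℝ (conn d a m n) x (frame d b x) + ∑ l, conn d a m l x * conn d b l n x
          - ∑ l, conn d b a l x * conn d l m n x) := by
  have hV : Ucomp d x ![a, b] m n = 0 :=
    congrFun (congrFun (congrFun (congrArg (fun p => p.1.2) hD) ![a, b]) m) n
  rw [Ucomp, sum_altSymbol_one_one] at hV
  simp only [frameDeriv_eq] at hV
  linarith

end Frame

/-! ### Algebraic consequences of the signature -/

section Signature

open Matrix

variable {ι : Type*} [Fintype ι] [DecidableEq ι] {g : Matrix ι ι ℝ}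

theorem isUnit_det_of_hasLorentzSignature
    (hsig : HasLorentzSignature fun v w : ι → ℝ => v ⬝ᵥ g.mulVec w) : IsUnit g.det := by
  rw [isUnit_iff_ne_zero]
  intro h0
  obtain ⟨v, hv, hgv⟩ := Matrix.exists_vecMul_eq_zero_iff.mpr h0
  refine hv (HasLorentzSignature.nondegenerate (B := Matrix.toLinearMap₂' ℝ g) ?_ fun w => ?_)
  · simpa only [Matrix.toLinearMap₂'_apply'] using hsig
  · rw [Matrix.toLinearMap₂'_apply', Matrix.dotProduct_mulVec, hgv, zero_dotProduct]

/-- Since `M g = -g Mᵀ`, the matrix `M` is similar to `-Mᵀ`. -/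
theorem trace_eq_zero_of_skew (hg : g.IsSymm) (hdet : IsUnit g.det) {M : Matrix ι ι ℝ}
    (hM : M * g + (M * g)ᵀ = 0) : M.trace = 0 := by
  have h1 : M = -(g * Mᵀ * g⁻¹) := by
    have : M * g = -(g * Mᵀ) := by
      rw [eq_neg_iff_add_eq_zero, ← hM, Matrix.transpose_mul, hg.eq]
    rw [← Matrix.neg_mul, ← this, Matrix.mul_nonsing_inv_cancel_right _ _ hdet]
  have h2 : M.trace = -M.trace := by
    conv_lhs => rw [h1, Matrix.trace_neg, Matrix.trace_mul_comm, ← Matrix.mul_assoc,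
      Matrix.nonsing_inv_mul _ hdet, Matrix.one_mul, Matrix.trace_transpose]
  linarith

end Signature

section Solution

open Topology Matrix

variable {ι : Type*} [Fintype ι] [DecidableEq ι] {d : R4 → Comp ι 1 × Comp ι 2} {U : Set R4}
  {g : Matrix ι ι ℝ}

theorem hasFDerivAt_of_contDiffOn {F : Type*} [NormedAddCommGroup F] [NormedSpace ℝ F]
    {h : R4 → F} (hU : IsOpen U) (hh : ContDiffOn ℝ ∞ h U) {x : R4} (hx : x ∈ U) :
    HasFDerivAt h (fderiv ℝ h x) x :=
  ((hh.contDiffAt (hU.mem_nhds hx)).differentiableAt (by simp)).hasFDerivAt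

/-! ### The 1-form `ν` -/

/-- The 1-form with `ν(E_a) = -½ Γ_{an}^n`. -/
def nuForm (d : R4 → Comp ι 1 × Comp ι 2) (x : R4) : R4 →L[ℝ] ℝ :=
  ∑ a, (-(1 / 2) * ∑ n, conn d a n n x) • dualFrame d a x

theorem contDiffOn_nuForm (hd : ContDiffOn ℝ ∞ d U) (hE : ∀ x ∈ U, FrameInvertible d x) :
    ContDiffOn ℝ ∞ (nuForm d) U :=
  ContDiffOn.sum fun a _ => (contDiffOn_const.mul
    (ContDiffOn.sum fun n _ => contDiffOn_conn hd a n n)).smul (contDiffOn_dualFrame hd hE a)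

theorem nuForm_frame {x : R4} (hE : FrameInvertible d x) (a : ι) :
    nuForm d x (frame d a x) = -(1 / 2) * ∑ n, conn d a n n x := by
  simp [nuForm, hE.dualFrame_frame]

/-- By the bracket formula, `dν(E_a, E_b)` is `-½` times the trace of the right side of `weyl_eq`;
the quadratic terms there form a commutator of matrices and have trace zero. -/
theorem fderiv_nuForm_symm (hU : IsOpen U) (hd : ContDiffOn ℝ ∞ d U)
    (hE : ∀ x ∈ U, FrameInvertible d x) {x : R4} (hx : x ∈ U) (hD : superD d x = 0)
    (htr : ∀ A, ∑ n, weyl d A n n x = 0) (v w : R4) :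
    fderiv ℝ (nuForm d) x v w = fderiv ℝ (nuForm d) x w v := by
  have key : ∀ v b, fderiv ℝ (nuForm d) x v (frame d b x)
      = -(1 / 2) * ∑ n, fderiv ℝ (conn d b n n) x v - nuForm d x (fderiv ℝ (frame d b) x v) := by
    intro v b
    have h1 := (hasFDerivAt_of_contDiffOn hU (contDiffOn_nuForm hd hE) hx).clm_apply
      (hasFDerivAt_of_contDiffOn hU (contDiffOn_frame hd b) hx)
    have h2 := (HasFDerivAt.fun_sum (u := Finset.univ) fun n _ =>
      hasFDerivAt_of_contDiffOn hU (contDiffOn_conn hd b n n) hx).const_mul (-(1 / 2) : ℝ)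
    have hev : (fun y => nuForm d y (frame d b y)) =ᶠ[𝓝 x]
        fun y => -(1 / 2) * ∑ n, conn d b n n y := by
      filter_upwards [hU.mem_nhds hx] with y hy using nuForm_frame (hE y hy) b
    have h3 := DFunLike.congr_fun (h1.unique (h2.congr_of_eventuallyEq hev)) v
    simp at h3
    simp
    linarith
  have hframe : ∀ a b, fderiv ℝ (nuForm d) x (frame d a x) (frame d b x)
      = fderiv ℝ (nuForm d) x (frame d b x) (frame d a x) := by
    intro a b
    have h1 := congrArg (nuForm d x) (fderiv_frame_sub hU hd hx hD a b)
    have h2 := htr ![a, b]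
    simp only [weyl_eq hD, Finset.sum_sub_distrib, Finset.sum_add_distrib] at h2
    rw [Finset.sum_comm (f := fun n l => conn d b n l x * conn d a l n x),
      Finset.sum_comm (f := fun n l => conn d a b l x * conn d l n n x),
      Finset.sum_comm (f := fun n l => conn d b a l x * conn d l n n x)] at h2
    simp only [map_sub, map_sum, map_smul, nuForm_frame (hE x hx), smul_eq_mul, sub_mul,
      Finset.sum_sub_distrib] at h1
    simp only [mul_left_comm _ (-(1 / 2) : ℝ), ← Finset.mul_sum] at h1 h2
    have h3 : ∑ l, ∑ n, conn d b n l x * conn d a l n x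
        = ∑ l, ∑ n, conn d a l n x * conn d b n l x :=
      Finset.sum_congr rfl fun _ _ => Finset.sum_congr rfl fun _ _ => mul_comm _ _
    rw [key, key]
    linarith
  refine (hE x hx).induction (p := fun v => ∀ w, fderiv ℝ (nuForm d) x v w
    = fderiv ℝ (nuForm d) x w v) (fun a => ?_) (fun v v' hv hv' w => ?_) (fun c v hv w => ?_)
    (fun w => by simp) v w
  · refine (hE x hx).induction (hframe a) (fun w w' hw hw' => ?_) (fun c w hw => ?_) (by simp)
    · simp [hw, hw']
    · simp [hw]
  · simp [hv, hv']
  · simp [hv]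

/-! ### The connection -/

/-- The connection form of the connection with `∇_{E_a} E_m = Γ_{am}^n E_n`. -/
def connForm (d : R4 → Comp ι 1 × Comp ι 2) (x : R4) : R4 →L[ℝ] R4 →L[ℝ] R4 :=
  ∑ m, (dualFrame d m x).smulRight
    -- The subtracted derivative of `E_m` cancels the flat part of `affineConn`.
    (∑ a, ∑ n, conn d a m n x • (dualFrame d a x).smulRight (frame d n x) - fderiv ℝ (frame d m) x)

theorem contDiffOn_connForm (hU : IsOpen U) (hd : ContDiffOn ℝ ∞ d U)
    (hE : ∀ x ∈ U, FrameInvertible d x) : ContDiffOn ℝ ∞ (connForm d) U :=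
  ContDiffOn.sum fun m _ => (contDiffOn_dualFrame hd hE m).smulRight <| ContDiffOn.sub
    (ContDiffOn.sum fun a _ => ContDiffOn.sum fun n _ => (contDiffOn_conn hd a m n).smul
      ((contDiffOn_dualFrame hd hE a).smulRight (contDiffOn_frame hd n)))
    ((contDiffOn_frame hd m).fderiv_of_isOpen hU (by simp))

theorem connForm_frame {x : R4} (hE : FrameInvertible d x) (m a : ι) :
    connForm d x (frame d m x) (frame d a x)
      = ∑ n, conn d a m n x • frame d n x - fderiv ℝ (frame d m) x (frame d a x) := by
  simp [connForm, hE.dualFrame_frame]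

theorem affineConn_connForm_frame {x : R4} (hE : FrameInvertible d x) (a m : ι) :
    affineConn (connForm d) (frame d m) x (frame d a x) = ∑ n, conn d a m n x • frame d n x := by
  simp [affineConn, connForm_frame hE]

/-- The flat derivative has no torsion, so symmetry of the connection form is vanishing of the
torsion, which on the frame is `T = 0`. -/
theorem connForm_symm (hU : IsOpen U) (hd : ContDiffOn ℝ ∞ d U)
    (hE : ∀ x ∈ U, FrameInvertible d x) {x : R4} (hx : x ∈ U) (hD : superD d x = 0) (v w : R4) :
    connForm d x v w = connForm d x w v := by
  have hframe : ∀ a b, connForm d x (frame d a x) (frame d b x)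
      = connForm d x (frame d b x) (frame d a x) := fun a b => by
    have h := fderiv_frame_sub hU hd hx hD a b
    rw [connForm_frame (hE x hx), connForm_frame (hE x hx)]
    simp only [sub_smul, Finset.sum_sub_distrib] at h
    linear_combination (exp := 1) h
  refine (hE x hx).induction (p := fun v => ∀ w, connForm d x v w = connForm d x w v)
    (fun a => ?_) (fun v v' hv hv' w => ?_) (fun c v hv w => ?_) (fun w => by simp) v w
  · refine (hE x hx).induction (hframe a) (fun w w' hw hw' => ?_) (fun c w hw => ?_) (by simp)
    · simp [hw, hw']
    · simp [hw]
  · simp [hv, hv']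
  · simp [hv]

/-! ### The metric -/

/-- The metric with `g(E_a, E_b) = e^f g_{ab}`. -/
def confMetric (d : R4 → Comp ι 1 × Comp ι 2) (g : Matrix ι ι ℝ) (f : R4 → ℝ) (x : R4) :
    R4 →L[ℝ] R4 →L[ℝ] ℝ :=
  ∑ a, ∑ b, g a b • (Real.exp (f x) • dualFrame d a x).smulRight (dualFrame d b x)

theorem contDiffOn_confMetric (hd : ContDiffOn ℝ ∞ d U) (hE : ∀ x ∈ U, FrameInvertible d x)
    {f : R4 → ℝ} (hf : ContDiffOn ℝ ∞ f U) : ContDiffOn ℝ ∞ (confMetric d g f) U :=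
  ContDiffOn.sum fun a _ => ContDiffOn.sum fun b _ =>
    ((hf.exp.smul (contDiffOn_dualFrame hd hE a)).smulRight
      (contDiffOn_dualFrame hd hE b)).const_smul (g a b)

omit [DecidableEq ι] in
theorem confMetric_apply (f : R4 → ℝ) (x v w : R4) :
    confMetric d g f x v w
      = Real.exp (f x) * ∑ a, ∑ b, g a b * (dualFrame d a x v * dualFrame d b x w) := by
  simp only [confMetric, Finset.mul_sum]
  simp
  exact Finset.sum_congr rfl fun _ _ => Finset.sum_congr rfl fun _ _ => by ring

theorem confMetric_frame {x : R4} (hE : FrameInvertible d x) (f : R4 → ℝ) (a b : ι) :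
    confMetric d g f x (frame d a x) (frame d b x) = Real.exp (f x) * g a b := by
  simp [confMetric_apply, hE.dualFrame_frame]

omit [DecidableEq ι] in
theorem confMetric_symm (hg : g.IsSymm) (f : R4 → ℝ) (x v w : R4) :
    confMetric d g f x v w = confMetric d g f x w v := by
  rw [confMetric_apply, confMetric_apply, Finset.sum_comm]
  simp only [hg.apply, mul_comm (dualFrame d _ x v)]

/-- The map `c ↦ e^{-f/2} c^a E_a` is an isometry from `g`, so it carries an orthonormal basis to an
orthonormal basis. -/
theorem confMetric_signature {x : R4} (hE : FrameInvertible d x)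
    (hsig : HasLorentzSignature fun v w : ι → ℝ => v ⬝ᵥ g.mulVec w) (f : R4 → ℝ) :
    HasLorentzSignature fun v w => confMetric d g f x v w := by
  obtain ⟨b, hb⟩ := hsig
  obtain ⟨e, he⟩ := hE.exists_equiv
  have hs : Real.exp (-(f x / 2)) ≠ 0 := (Real.exp_pos _).ne'
  refine ⟨(b.map e.toLinearEquiv).map (LinearEquiv.smulOfNeZero ℝ R4 _ hs), fun i j => ?_⟩
  have hdual : ∀ c a, dualFrame d a x (e c) = c a := fun c a => by
    rw [← e.coe_coe, he, dualFrame, ContinuousLinearMap.comp_apply, hE.coframe_frameMap]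
    rfl
  have hexp : Real.exp (f x) * Real.exp (-(f x / 2)) * Real.exp (-(f x / 2)) = 1 := by
    rw [← Real.exp_add, ← Real.exp_add, ← Real.exp_zero]
    ring_nf
  have h1 : confMetric d g f x (Real.exp (-(f x / 2)) • e (b i)) (Real.exp (-(f x / 2)) • e (b j))
      = b i ⬝ᵥ g.mulVec (b j) := by
    rw [map_smul, map_smul, _root_.smul_apply, confMetric_apply, smul_eq_mul,
      smul_eq_mul, ← mul_assoc, ← mul_assoc, mul_comm _ (Real.exp (f x)), ← mul_assoc, hexp,
      one_mul]
    simp only [hdual, dotProduct, Matrix.mulVec, Finset.mul_sum]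
    exact Finset.sum_congr rfl fun _ _ => Finset.sum_congr rfl fun _ _ => by ring
  exact h1.trans (hb i j)

theorem isLorentzianMetricOn_confMetric (hd : ContDiffOn ℝ ∞ d U)
    (hE : ∀ x ∈ U, FrameInvertible d x) (hg : g.IsSymm)
    (hsig : HasLorentzSignature fun v w : ι → ℝ => v ⬝ᵥ g.mulVec w) {f : R4 → ℝ}
    (hf : ContDiffOn ℝ ∞ f U) : IsLorentzianMetricOn U (confMetric d g f) where
  smooth := contDiffOn_confMetric hd hE hf
  symm x _ v w := confMetric_symm hg f x v w
  signature x hx := confMetric_signature (hE x hx) hsig f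

/-- On the frame, `E_a(e^f g_{bc}) = e^f (E_a f) g_{bc}` with `E_a f = ½ Γ_{an}^n`, and the
condition of `S^1` equates this with `e^f (Γ_{ab}^l g_{lc} + Γ_{ac}^l g_{lb})`. -/
theorem fderiv_confMetric (hU : IsOpen U) (hd : ContDiffOn ℝ ∞ d U)
    (hE : ∀ x ∈ U, FrameInvertible d x) (hg : g.IsSymm) {f : R4 → ℝ} (hf : ContDiffOn ℝ ∞ f U)
    {x : R4} (hx : x ∈ U) (hS : (d x).1 ∈ S g 1) (hν : nuForm d x = -fderiv ℝ f x) (u v w : R4) :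
    fderiv ℝ (confMetric d g f) x u v w
      = confMetric d g f x (connForm d x v u) w + confMetric d g f x v (connForm d x w u) := by
  have hframe : ∀ a b c, fderiv ℝ (confMetric d g f) x (frame d a x) (frame d b x) (frame d c x)
      = confMetric d g f x (connForm d x (frame d b x) (frame d a x)) (frame d c x)
        + confMetric d g f x (frame d b x) (connForm d x (frame d c x) (frame d a x)) := by
    intro a b c
    have h1 := ((hasFDerivAt_of_contDiffOn hU (contDiffOn_confMetric (g := g) hd hE hf)
      hx).clm_apply (hasFDerivAt_of_contDiffOn hU (contDiffOn_frame hd b) hx)).clm_apply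
      (hasFDerivAt_of_contDiffOn hU (contDiffOn_frame hd c) hx)
    have h2 := (hasFDerivAt_of_contDiffOn hU hf hx).exp.mul_const (g b c)
    have hev : (fun y => confMetric d g f y (frame d b y) (frame d c y)) =ᶠ[𝓝 x]
        fun y => Real.exp (f y) * g b c := by
      filter_upwards [hU.mem_nhds hx] with y hy using confMetric_frame (hE y hy) f b c
    have h3 := DFunLike.congr_fun (h1.unique (h2.congr_of_eventuallyEq hev)) (frame d a x)
    simp at h3
    have h4 := nuForm_frame (hE x hx) a
    rw [hν] at h4
    have h5 : ∑ l, conn d a b l x * g l c + ∑ l, conn d a c l x * g l b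
        = 1 / 2 * (∑ l, conn d a l l x) * g b c := hS.2.2 ![a] b c
    rw [connForm_frame (hE x hx), connForm_frame (hE x hx)]
    simp only [map_sub, map_sum, map_smul, _root_.sub_apply, _root_.sum_apply,
      _root_.smul_apply, confMetric_frame (hE x hx), smul_eq_mul,
      mul_left_comm _ (Real.exp (f x)), ← Finset.mul_sum]
    have h6 : ∑ n, conn d a c n x * g b n = ∑ n, conn d a c n x * g n b :=
      Finset.sum_congr rfl fun n _ => by rw [hg.apply]
    rw [h6]
    simp only [_root_.neg_apply] at h4
    linear_combination h3 - Real.exp (f x) * h5 - Real.exp (f x) * g b c * h4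
  refine (hE x hx).induction (p := fun u => ∀ v w, fderiv ℝ (confMetric d g f) x u v w
      = confMetric d g f x (connForm d x v u) w + confMetric d g f x v (connForm d x w u))
    (fun a => (hE x hx).induction (p := fun v => ∀ w, _) (fun b => (hE x hx).induction (hframe a b)
      ?_ ?_ ?_) ?_ ?_ ?_) ?_ ?_ ?_ u v w
  · intro w w' h h'; simp [h, h']; ring
  · intro k w h; simp [h]; ring
  · simp
  · intro w w' h h' _; simp [h, h']; ring
  · intro k w h _; simp [h]; ring
  · simp
  · intro w w' h h' _ _; simp [h, h']; ring
  · intro k w h _ _; simp [h]; ring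
  · simp

end Solution

/-! ### Curvature in the frame and its trace. -/

section Curvature

open Topology

variable {ι : Type*} [Fintype ι] {d : R4 → Comp ι 1 × Comp ι 2} {U : Set R4}
  {η : R4 → R4 →L[ℝ] R4 →L[ℝ] R4}

theorem affineConn_congr {Y Z : R4 → R4} {x : R4} (h : Y =ᶠ[𝓝 x] Z) :
    affineConn η Y x = affineConn η Z x := by
  rw [affineConn, affineConn, h.fderiv_eq, h.eq_of_nhds]

theorem affineConn_sum_smul {h : ι → R4 → ℝ} {Y : ι → R4 → R4} {x : R4}
    (hh : ∀ n, DifferentiableAt ℝ (h n) x) (hY : ∀ n, DifferentiableAt ℝ (Y n) x) :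
    affineConn η (fun y => ∑ n, h n y • Y n y) x
      = ∑ n, (h n x • affineConn η (Y n) x + (fderiv ℝ (h n) x).smulRight (Y n x)) := by
  rw [affineConn, fderiv_fun_sum fun n _ => (hh n).fun_smul (hY n), map_sum,
    ← Finset.sum_add_distrib]
  exact Finset.sum_congr rfl fun n _ => affineConn_smul (hh n) (hY n)

variable [DecidableEq ι]

theorem affineConn_affineConn_frame (hU : IsOpen U) (hd : ContDiffOn ℝ ∞ d U)
    (hE : ∀ x ∈ U, FrameInvertible d x) {x : R4} (hx : x ∈ U) (a b m : ι) :
    affineConn (connForm d) (fun y => affineConn (connForm d) (frame d m) y (frame d b y)) x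
        (frame d a x)
      = ∑ n, (fderiv ℝ (conn d b m n) x (frame d a x)
          + ∑ l, conn d b m l x * conn d a l n x) • frame d n x := by
  have hev : (fun y => affineConn (connForm d) (frame d m) y (frame d b y)) =ᶠ[𝓝 x]
      fun y => ∑ n, conn d b m n y • frame d n y := by
    filter_upwards [hU.mem_nhds hx] with y hy using affineConn_connForm_frame (hE y hy) b m
  rw [affineConn_congr hev, affineConn_sum_smul
    (fun n => (hasFDerivAt_of_contDiffOn hU (contDiffOn_conn hd b m n) hx).differentiableAt)
    (fun n => (hasFDerivAt_of_contDiffOn hU (contDiffOn_frame hd n) hx).differentiableAt)]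
  simp only [sum_apply, add_apply, smul_apply, ContinuousLinearMap.smulRight_apply,
    affineConn_connForm_frame (hE x hx), Finset.sum_add_distrib, Finset.smul_sum, smul_smul,
    add_smul, Finset.sum_smul]
  rw [Finset.sum_comm, add_comm]

/-- The bracket formula turns `∇_{[E_a, E_b]} E_m` into the antisymmetrised `Γ_{ab}^l Γ_{lm}^n`,
after which the curvature is the right side of `weyl_eq`. -/
theorem curvature_frame (hU : IsOpen U) (hd : ContDiffOn ℝ ∞ d U)
    (hE : ∀ x ∈ U, FrameInvertible d x) {x : R4} (hx : x ∈ U) (hD : superD d x = 0) (a b m : ι) :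
    curvature (affineConn (connForm d)) (frame d a) (frame d b) (frame d m) x
      = ∑ n, weyl d ![a, b] m n x • frame d n x := by
  rw [curvature, affineConn_affineConn_frame hU hd hE hx, affineConn_affineConn_frame hU hd hE hx,
    VectorField.lieBracket, fderiv_frame_sub hU hd hx hD]
  have h : ∑ l, (conn d a b l x - conn d b a l x) •
        (∑ n, conn d l m n x • frame d n x)
      = ∑ n, (∑ l, (conn d a b l x - conn d b a l x) * conn d l m n x) • frame d n x := by
    simp only [Finset.smul_sum, smul_smul, Finset.sum_smul]
    exact Finset.sum_comm
  simp only [map_sum, map_smul, affineConn_connForm_frame (hE x hx)]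
  rw [h, ← Finset.sum_sub_distrib, ← Finset.sum_sub_distrib]
  refine Finset.sum_congr rfl fun n _ => ?_
  rw [← sub_smul, ← sub_smul, weyl_eq hD]
  simp only [sub_mul, Finset.sum_sub_distrib]
  congr 1
  ring

/-! ### The Ricci curvature -/

/-- The endomorphism `v ↦ R(v, y) z` of the connection `d + η`. -/
def curvEnd (η : R4 → R4 →L[ℝ] R4 →L[ℝ] R4) (x y z : R4) : R4 →ₗ[ℝ] R4 where
  toFun v := fderiv ℝ η x v z y - fderiv ℝ η x y z v + η x (η x z y) v - η x (η x z v) y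
  map_add' v w := by simp; abel
  map_smul' c v := by simp [smul_sub, smul_add]

/-- The trace of `v ↦ R(v, y) z`, as a bilinear form. -/
def ricciForm (η : R4 → R4 →L[ℝ] R4 →L[ℝ] R4) (x : R4) : R4 →ₗ[ℝ] R4 →ₗ[ℝ] ℝ :=
  (LinearMap.mk₂ ℝ (curvEnd η x)
    (fun y y' z => LinearMap.ext fun v => by simp [curvEnd]; abel)
    (fun c y z => LinearMap.ext fun v => by simp [curvEnd, smul_sub, smul_add])
    (fun y z z' => LinearMap.ext fun v => by simp [curvEnd]; abel)
    (fun c y z => LinearMap.ext fun v => by simp [curvEnd, smul_sub, smul_add])).compr₂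
    (LinearMap.trace ℝ R4)

theorem ricciForm_apply (x y z : R4) :
    ricciForm η x y z = LinearMap.trace ℝ R4 (curvEnd η x y z) := rfl

/-- Tensoriality of the curvature makes the coordinate sum a basis-free trace, which can then be
computed in the frame. -/
theorem ricci_affineConn (hU : IsOpen U) (hη : ContDiffOn ℝ ∞ η U)
    (hsymm : ∀ x ∈ U, ∀ v w, η x v w = η x w v) {Y Z : R4 → R4}
    (hY : ContDiffOn ℝ ∞ Y U) (hZ : ContDiffOn ℝ ∞ Z U) {x : R4} (hx : x ∈ U) :
    ricci (affineConn η) Y Z x = ricciForm η x (Y x) (Z x) := by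
  rw [ricciForm_apply, LinearMap.trace_eq_matrix_trace ℝ (Pi.basisFun ℝ (Fin 4)), ricci,
    Matrix.trace]
  refine Finset.sum_congr rfl fun μ _ => ?_
  rw [curvature_affineConn hU hη hsymm contDiffOn_const hY hZ hx]
  simp [curvEnd]

theorem ricciForm_connForm (hU : IsOpen U) (hd : ContDiffOn ℝ ∞ d U)
    (hE : ∀ x ∈ U, FrameInvertible d x) {x : R4} (hx : x ∈ U)
    (hD : ∀ x ∈ U, superD d x = 0) (htr : ∀ b m, ∑ a, weyl d ![a, b] m a x = 0) :
    ricciForm (connForm d) x = 0 := by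
  obtain ⟨β, hβ, hrepr⟩ := (hE x hx).exists_basis
  refine LinearMap.ext_basis β β fun b m => ?_
  rw [ricciForm_apply, LinearMap.trace_eq_matrix_trace ℝ β, Matrix.trace, LinearMap.zero_apply,
    LinearMap.zero_apply, ← htr b m]
  refine Finset.sum_congr rfl fun a _ => ?_
  have h1 : curvEnd (connForm d) x (frame d b x) (frame d m x) (frame d a x)
      = ∑ n, weyl d ![a, b] m n x • frame d n x := by
    rw [← curvature_frame hU hd hE hx (hD x hx), curvature_affineConn hU
      (contDiffOn_connForm hU hd hE) (fun y hy => connForm_symm hU hd hE hy (hD y hy))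
      (contDiffOn_frame hd a) (contDiffOn_frame hd b) (contDiffOn_frame hd m) hx]
    rfl
  rw [Matrix.diag_apply, LinearMap.toMatrix_apply, hβ, hβ, hβ, h1, hrepr, map_sum]
  simp [(hE x hx).dualFrame_frame]

end Curvature

/-! ### Symmetries of elements of `S²_vac` -/

section Vacuum

variable {ι : Type*} [Fintype ι] [DecidableEq ι] {g : Matrix ι ι ℝ} {p : Comp ι 2}

theorem S2vac_trace_eq_zero (hg : g.IsSymm) (hdet : IsUnit g.det) (hp : p ∈ S2vac g)
    (A : Fin 2 → ι) : ∑ n, p.2 A n n = 0 := by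
  refine trace_eq_zero_of_skew (M := Matrix.of (p.2 A)) hg hdet ?_
  ext m n
  exact hp.2.2.2.1 A m n

/-- The Ricci trace contracts the first form index and `S2vac` the second; antisymmetry of the pair
exchanges them. -/
theorem S2vac_ricci_eq_zero (hp : p ∈ S2vac g) (b m : ι) : ∑ a, p.2 ![a, b] m a = 0 := by
  have h : ∀ a, p.2 ![a, b] m a = -p.2 ![b, a] m a := fun a => by
    have := hp.1.2.1 (Equiv.swap 0 1) ![b, a] m a
    have hA : ![b, a] ∘ Equiv.swap (0 : Fin 2) 1 = ![a, b] := by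
      ext i
      fin_cases i <;> simp
    rw [hA] at this
    simpa using this
  simp only [h, Finset.sum_neg_distrib, hp.2.2.2.2 b m, neg_zero]

end Vacuum

theorem exists_contDiffOn_eq_neg_fderiv {U : Set R4} (hU : IsOpen U)
    (hUsc : SimplyConnectedSpace U) {ν : R4 → R4 →L[ℝ] ℝ} (hν : ContDiffOn ℝ ∞ ν U)
    (hdν : ∀ x ∈ U, ∀ v w, fderiv ℝ ν x v w = fderiv ℝ ν x w v) :
    ∃ f : R4 → ℝ, ContDiffOn ℝ ∞ f U ∧ ∀ x ∈ U, ν x = -fderiv ℝ f x := by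
  obtain ⟨F, hF⟩ := exists_forall_hasFDerivAt_of_simplyConnectedSpace hU hUsc
    (hν.differentiableOn (by simp)) hdν
  refine ⟨-F, ?_, fun x hx => ?_⟩
  · refine ((contDiffOn_infty_iff_fderiv_of_isOpen hU).mpr
      ⟨fun x hx => (hF x hx).differentiableAt.differentiableWithinAt, ?_⟩).neg
    exact hν.congr fun x hx => (hF x hx).fderiv
  · rw [fderiv_neg, (hF x hx).fderiv, neg_neg]

end Diamond

end

theorem mainTheorem8 {ι : Type*} [Fintype ι] [DecidableEq ι] (hι : Fintype.card ι = 4)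
    (g : Matrix ι ι ℝ) (hg : g.IsSymm)
    (hsig : Diamond.HasLorentzSignature fun v w : ι → ℝ => v ⬝ᵥ g.mulVec w)
    (U : Set Diamond.R4) (hU : IsOpen U) (hUsc : SimplyConnectedSpace U)
    (d : Diamond.R4 → Diamond.Comp ι 1 × Diamond.Comp ι 2)
    (hd : ContDiffOn ℝ ∞ d U)
    (hS : ∀ x ∈ U, (d x).1 ∈ Diamond.S g 1 ∧ (d x).2 ∈ Diamond.S2vac g)
    (hD : ∀ x ∈ U, Diamond.superD d x = 0)
    (hE : ∀ x ∈ U, ∃ N : Matrix (Fin 4) ι ℝ,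
      Diamond.frameMatrix d x * N = 1 ∧ N * Diamond.frameMatrix d x = 1) :
    ∃ ν : Diamond.R4 → Diamond.R4 →L[ℝ] ℝ,
      ContDiffOn ℝ ∞ ν U ∧
      (∀ x ∈ U, ∀ a, ν x (Diamond.frame d a x) = -(1 / 2) * ∑ n, Diamond.conn d a n n x) ∧
      (∃ f : Diamond.R4 → ℝ, ContDiffOn ℝ ∞ f U ∧ ∀ x ∈ U, ν x = -fderiv ℝ f x) ∧
      ∀ f : Diamond.R4 → ℝ, ContDiffOn ℝ ∞ f U → (∀ x ∈ U, ν x = -fderiv ℝ f x) →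
        ∃ G : Diamond.R4 → Diamond.R4 →L[ℝ] Diamond.R4 →L[ℝ] ℝ,
          Diamond.IsLorentzianMetricOn U G ∧
          (∀ x ∈ U, ∀ a b,
            G x (Diamond.frame d a x) (Diamond.frame d b x) = Real.exp (f x) * g a b) ∧
          ∃ D : (Diamond.R4 → Diamond.R4) → Diamond.R4 → Diamond.R4 →L[ℝ] Diamond.R4,
            Diamond.IsLeviCivitaOn U G D ∧
            (∀ D', Diamond.IsLeviCivitaOn U G D' →
              ∀ Y, ∀ x ∈ U, DifferentiableAt ℝ Y x → D' Y x = D Y x) ∧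
            (∀ x ∈ U, ∀ a m, D (Diamond.frame d m) x (Diamond.frame d a x)
              = ∑ n, Diamond.conn d a m n x • Diamond.frame d n x) ∧
            (∀ x ∈ U, ∀ a b m,
              Diamond.curvature D (Diamond.frame d a) (Diamond.frame d b) (Diamond.frame d m) x
                = ∑ n, Diamond.weyl d ![a, b] m n x • Diamond.frame d n x) ∧
            (∀ Y Z : Diamond.R4 → Diamond.R4, ContDiffOn ℝ ∞ Y U → ContDiffOn ℝ ∞ Z U →
              ∀ x ∈ U, Diamond.ricci D Y Z x = 0) := by
  have hD0 := fun x hx => Diamond.connForm_symm hU hd hE hx (hD x hx)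
  have hdet := Diamond.isUnit_det_of_hasLorentzSignature hsig
  have hη := Diamond.contDiffOn_connForm hU hd hE
  refine ⟨Diamond.nuForm d, Diamond.contDiffOn_nuForm hd hE,
    fun x hx => Diamond.nuForm_frame (hE x hx), ?_, fun f hf hνf => ?_⟩
  · exact Diamond.exists_contDiffOn_eq_neg_fderiv hU hUsc (Diamond.contDiffOn_nuForm hd hE)
      fun x hx => Diamond.fderiv_nuForm_symm hU hd hE hx (hD x hx)
        (Diamond.S2vac_trace_eq_zero hg hdet (hS x hx).2)
  · have hG := Diamond.isLorentzianMetricOn_confMetric hd hE hg hsig hf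
    -- The connection does not depend on `f`, which enters compatibility only through `df = -ν` and
    -- the factor `e^f`.
    have hLC : Diamond.IsLeviCivitaOn U (Diamond.confMetric d g f)
        (Diamond.affineConn (Diamond.connForm d)) :=
      Diamond.isLeviCivitaOn_affineConn hU hη hG.smooth hD0 fun x hx =>
        Diamond.fderiv_confMetric hU hd hE hg hf hx (hS x hx).1 (hνf x hx)
    refine ⟨Diamond.confMetric d g f, hG, fun x hx => Diamond.confMetric_frame (hE x hx) f,
      Diamond.affineConn (Diamond.connForm d), hLC,
      fun D' hD' Y x hx hY => hLC.eq_of_differentiableAt hG hD' hx hY,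
      fun x hx => Diamond.affineConn_connForm_frame (hE x hx),
      fun x hx => Diamond.curvature_frame hU hd hE hx (hD x hx), fun Y Z hY hZ x hx => ?_⟩
    rw [Diamond.ricci_affineConn hU hη hD0 hY hZ hx, Diamond.ricciForm_connForm hU hd hE hx hD
      (Diamond.S2vac_ricci_eq_zero (hS x hx).2)]
    rfl
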